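/- Let $b\in\mathbb R$, $c\ge 0$, let $m$ be a measure on $(0,\infty)$ with $\int_0^\infty (u\wedge u^2)\,m(du)<\infty$, and let $\phi(z)=bz+cz^2+\int_0^\infty(e^{-zu}-1+zu)\,m(du)$ for $z\ge 0$. Let $(Q_t)_{t\ge 0}$ be the transition semigroup on $[0,\infty)$ of the continuous-state branching process with branching mechanism $\phi$, that is, $\int_{[0,\infty)}e^{-\lambda y}\,Q_t(x,dy)=e^{-xv_t(\lambda)}$ for $t,x,\lambda\ge 0$, where for each $\lambda\ge 0$ the map $t\mapsto v_t(\lambda)$ is the unique locally bounded nonnegative solution of $v_t(\lambda)=\lambda-\int_0^t\phi(v_s(\lambda))\,ds$. Assume that $b\ge 0$ and that Grey's condition holds: for some $\theta>0$, $\phi(z)>0$ for all $z\ge\theta$ and $\int_\theta^\infty\phi(z)^{-1}\,dz<\infty$. Let $x>0$ and $t\ge 0$. Let $(x(s))_{s\ge 0}$ be, under the probability measure $\mathbf Q_x$, a $[0,\infty)$-valued càdlàg Markov process with respect to a filtration $(\mathcal F_s)_{s\ge 0}$, with transition semigroup $(Q_s)_{s\ge 0}$ and $x(0)=x$ almost surely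 (for example, a Hunt realization of the process with its augmented natural filtration), and let $\tau_0=\inf\{s\ge 0:x(s)=0\}$, with $\inf\emptyset=\infty$. Then $\mathbf Q_x\{r+t<\tau_0\}>0$ for all $r\ge 0$, and: (i) $Q^b_t(x,dy):=e^{bt}x^{-1}y\,Q_t(x,dy)$ is a probability measure, and the law of $x(t)$ under $\mathbf Q_x\{\,\cdot\mid r+t<\tau_0\}$ converges weakly to $Q^b_t(x,\cdot)$ as $r\to\infty$; (ii) for every bounded $\mathcal F_t$-measurable real random variable $F$, the variable $e^{bt}x(t)F/x$ is $\mathbf Q_x$-integrable and $$\lim_{r\to\infty}\mathbf Q_x[F\mid r+t<\tau_0]=\mathbf Q_x\big[e^{bt}x^{-1}x(t)F\big].$$ -/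

import Mathlib

open MeasureTheory ProbabilityTheory Filter Topology
open scoped NNReal ENNReal

/-- The parameters `(b, c, m)` of a branching mechanism: `b ∈ ℝ`, `c ≥ 0` and a measure `m`
on `(0, ∞)` (a measure on `ℝ` that does not charge `(-∞, 0]`) for which
`(u ∧ u²) m(du)` is a finite measure. -/
structure BranchingMechanism where
  /-- the linear coefficient -/
  b : ℝ
  /-- the quadratic coefficient -/
  c : ℝ
  /-- the jump measure -/
  m : Measure ℝ
  c_nonneg : 0 ≤ c
  m_Iic : m (Set.Iic 0) = 0
  m_finite : ∫⁻ u, ENNReal.ofReal (min u (u ^ 2)) ∂m < ∞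

namespace BranchingMechanism

/-- The branching mechanism as a function of `z ≥ 0`:
`φ(z) = b z + c z² + ∫ (e^{-zu} - 1 + zu) m(du)`. -/
noncomputable def phi (ψ : BranchingMechanism) (z : ℝ) : ℝ :=
  ψ.b * z + ψ.c * z ^ 2 + ∫ u, (Real.exp (-(z * u)) - 1 + z * u) ∂ψ.m

/-- Grey's condition: for some `θ > 0`, `φ > 0` on `[θ, ∞)` and `∫_θ^∞ φ(z)⁻¹ dz < ∞`. -/
def Grey (ψ : BranchingMechanism) : Prop :=
  ∃ θ : ℝ, 0 < θ ∧ (∀ z, θ ≤ z → 0 < ψ.phi z) ∧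
    IntegrableOn (fun z => (ψ.phi z)⁻¹) (Set.Ioi θ)

/-- `v t l` (for `t, l ≥ 0`) is the cumulant semigroup of the branching mechanism: for every
`l ≥ 0`, `t ↦ v t l` is the nonnegative, locally bounded solution of
`v_t(l) = l - ∫_0^t φ(v_s(l)) ds`. -/
structure IsCumulantSemigroup (ψ : BranchingMechanism) (v : ℝ → ℝ → ℝ) : Prop where
  nonneg : ∀ t l, 0 ≤ t → 0 ≤ l → 0 ≤ v t l
  locally_bounded : ∀ T l, 0 ≤ T → 0 ≤ l → ∃ K, ∀ t, 0 ≤ t → t ≤ T → v t l ≤ K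
  intervalIntegrable : ∀ t l, 0 ≤ t → 0 ≤ l →
    IntervalIntegrable (fun s => ψ.phi (v s l)) volume 0 t
  integral_eq : ∀ t l, 0 ≤ t → 0 ≤ l → v t l = l - ∫ s in (0 : ℝ)..t, ψ.phi (v s l)

/-- `Q` is the transition semigroup on `ℝ₊` of the CB-process with the given branching mechanism:
`∫ e^{-l y} Q_t(x, dy) = e^{-x v_t(l)}` for `t, x, l ≥ 0`, with `v` the cumulant semigroup. -/
structure IsCBSemigroup (ψ : BranchingMechanism) (Q : ℝ≥0 → Kernel ℝ≥0 ℝ≥0) : Prop where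
  isMarkovKernel : ∀ t, IsMarkovKernel (Q t)
  laplace : ∃ v : ℝ → ℝ → ℝ, ψ.IsCumulantSemigroup v ∧ ∀ t x l : ℝ≥0,
    ∫ y : ℝ≥0, Real.exp (-((l : ℝ) * (y : ℝ))) ∂(Q t x) = Real.exp (-((x : ℝ) * v t l))

end BranchingMechanism

/-- Under the law `P`, the `ℝ₊`-valued process `X` is a càdlàg Markov process with respect to the
filtration `ℱ` (to which it is adapted), with transition semigroup `Q` and initial state `x`. -/
structure IsCadlagMarkov {Ω : Type*} {mΩ : MeasurableSpace Ω} (Q : ℝ≥0 → Kernel ℝ≥0 ℝ≥0)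
    (ℱ : Filtration ℝ≥0 mΩ) (X : ℝ≥0 → Ω → ℝ≥0) (P : Measure Ω) (x : ℝ≥0) : Prop where
  adapted : ∀ t, Measurable[ℱ t] (X t)
  right_continuous : ∀ ω t, ContinuousWithinAt (fun s => X s ω) (Set.Ici t) t
  left_limits : ∀ ω t, 0 < t → ∃ y, Tendsto (fun s => X s ω) (𝓝[<] t) (𝓝 y)
  initial : ∀ᵐ ω ∂P, X 0 ω = x
  markov : ∀ (s t : ℝ≥0) (f : ℝ≥0 → ℝ), Measurable f → (∃ C, ∀ y, |f y| ≤ C) →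
    P[fun ω => f (X (s + t) ω) | ℱ s] =ᵐ[P] fun ω => ∫ y, f y ∂(Q t (X s ω))

/-- The extinction time `τ₀ = inf {s ≥ 0 : X s = 0}`, with `inf ∅ = ∞`. -/
noncomputable def extinctionTime {Ω : Type*} (X : ℝ≥0 → Ω → ℝ≥0) (ω : Ω) : ℝ≥0∞ :=
  ⨅ (s : ℝ≥0) (_ : X s ω = 0), (s : ℝ≥0∞)

/-- The event `{s < τ₀}`. -/
def survival {Ω : Type*} (X : ℝ≥0 → Ω → ℝ≥0) (s : ℝ≥0) : Set Ω :=
  {ω | (s : ℝ≥0∞) < extinctionTime X ω}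

/-- The size-biased kernel `Q^b_t(x, dy) = e^{bt} x⁻¹ y Q_t(x, dy)` for `x > 0`. The density
vanishes at `0`, so that this measure is carried by `(0, ∞)`. -/
noncomputable def sizeBiased (b : ℝ) (Q : ℝ≥0 → Kernel ℝ≥0 ℝ≥0) (t x : ℝ≥0) : Measure ℝ≥0 :=
  (Q t x).withDensity
    (fun y => ENNReal.ofReal (Real.exp (b * (t : ℝ)) * (x : ℝ)⁻¹ * (y : ℝ)))

/-!
Write `v̄_r = lim_{l → ∞} v_r(l)`. The proof rests on three facts about the solution of
`∂ₜ vₜ(l) = -φ(vₜ(l))`: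

* separating variables gives `∫_{v_t(l)}^l dz / φ(z) = t`, so Grey's condition makes `v_t(l)` bounded
  in `l` for `t > 0` (`IsCumulantSemigroup.bounded`); hence `0 < v̄_r < ∞` and
  `Q_r(y, {0}) = e^{-y v̄_r}` (`real_singleton_zero`);
* `v_t(l) → 0` as `t → ∞` (`IsCumulantSemigroup.tendsto_atTop`), hence `v̄_r → 0`;
* since `φ(z) / z` decreases to `b` as `z ↓ 0`, `v_t(l) / l → e^{-bt}` as `l ↓ 0`
  (`IsCumulantSemigroup.tendsto_div`).

On the probabilistic side, `{s < τ₀}` is almost surely equal to `{X_s ≠ 0}` because `0` is a trap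
(`survival_ae_eq`). Instead of the strong Markov property, this uses the Markov property at the
first time of a finite set at which the path is below `ε`, and right continuity. In particular
`{s < τ₀}`, which need not be measurable, is null measurable, so that conditioning on it makes sense.

By the Markov property at time `t`, for bounded `ℱ_t`-measurable `F`,
`E[F | r + t < τ₀] = E[F (1 - e^{-X_t v̄_r})] / (1 - e^{-x v_t(v̄_r)})`.
After division of numerator and denominator by `v̄_r → 0`, dominated convergence (with dominating
variable a multiple of `X_t`, integrable by `integrable_process`) gives the limit
`E[F X_t] / (x e^{-bt})`. Taking `F = 1` shows that the size-biased measure has mass one, and taking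
`F = g(X_t)` with `g` bounded continuous gives the weak convergence.
-/

/-! ### Analysis of the branching mechanism -/

theorem exp_neg_sub_one_add_nonneg (y : ℝ) : 0 ≤ Real.exp (-y) - 1 + y := by
  linarith [Real.add_one_le_exp (-y)]

theorem exp_neg_sub_one_add_le_self {y : ℝ} (hy : 0 ≤ y) : Real.exp (-y) - 1 + y ≤ y := by
  linarith [Real.exp_le_one_iff.2 (neg_nonpos.2 hy)]

theorem exp_neg_sub_one_add_le_sq {y : ℝ} (hy : 0 ≤ y) : Real.exp (-y) - 1 + y ≤ y ^ 2 := by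
  have h1 : Real.exp (-y) * (1 + y) ≤ 1 := by
    calc Real.exp (-y) * (1 + y) ≤ Real.exp (-y) * Real.exp y := by
          gcongr
          linarith [Real.add_one_le_exp y]
      _ = 1 := by rw [← Real.exp_add]; simp
  have h2 : Real.exp (-y) ≤ 1 - y + y ^ 2 := by
    have h3 : 1 ≤ (1 - y + y ^ 2) * (1 + y) := by nlinarith [pow_nonneg hy 3]
    exact le_of_mul_le_mul_right (h1.trans h3) (by linarith)
  linarith

/-- Convexity of `y ↦ e^{-y} - 1 + y`, which vanishes at `0`. -/
theorem exp_neg_sub_one_add_mul_le {k : ℝ} (hk0 : 0 ≤ k) (hk1 : k ≤ 1) (y : ℝ) :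
    Real.exp (-(k * y)) - 1 + k * y ≤ k * (Real.exp (-y) - 1 + y) := by
  have h := convexOn_exp.2 (Set.mem_univ (-y)) (Set.mem_univ 0) hk0 (sub_nonneg.2 hk1) (by ring)
  simp only [smul_eq_mul, mul_neg, mul_zero, add_zero, Real.exp_zero, mul_one] at h
  linarith

namespace BranchingMechanism

variable (ψ : BranchingMechanism)

theorem ae_pos : ∀ᵐ u ∂ψ.m, 0 < u := by
  have : {u : ℝ | ¬ 0 < u} = Set.Iic 0 := by ext; simp
  rw [ae_iff, this]
  exact ψ.m_Iic

theorem integrable_min : Integrable (fun u : ℝ => min u (u ^ 2)) ψ.m := by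
  refine ⟨by fun_prop, ?_⟩
  rw [hasFiniteIntegral_iff_ofReal]
  · exact ψ.m_finite
  · filter_upwards [ψ.ae_pos] with u hu
    exact le_min hu.le (sq_nonneg u)

theorem exp_neg_sub_one_add_le_mul_min {z K u : ℝ} (hz : 0 ≤ z) (hzK : z ≤ K) (hu : 0 ≤ u) :
    Real.exp (-(z * u)) - 1 + z * u ≤ (K + K ^ 2) * min u (u ^ 2) := by
  have hK := hz.trans hzK
  have h1 := exp_neg_sub_one_add_le_self (mul_nonneg hz hu)
  have h2 := exp_neg_sub_one_add_le_sq (mul_nonneg hz hu)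
  have h3 : z * u ≤ K * u := by gcongr
  have h4 : (z * u) ^ 2 ≤ (K * u) ^ 2 := by gcongr
  rcases min_choice u (u ^ 2) with h | h <;> rw [h]
  · nlinarith [mul_nonneg (sq_nonneg K) hu]
  · nlinarith [mul_nonneg hK (sq_nonneg u)]

theorem integrable_jump {z : ℝ} (hz : 0 ≤ z) :
    Integrable (fun u : ℝ => Real.exp (-(z * u)) - 1 + z * u) ψ.m := by
  refine (ψ.integrable_min.const_mul (z + z ^ 2)).mono' (by fun_prop) ?_
  filter_upwards [ψ.ae_pos] with u hu
  rw [Real.norm_of_nonneg (exp_neg_sub_one_add_nonneg _)]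
  exact exp_neg_sub_one_add_le_mul_min hz le_rfl hu.le

theorem jump_nonneg (z : ℝ) : 0 ≤ ∫ u, (Real.exp (-(z * u)) - 1 + z * u) ∂ψ.m :=
  integral_nonneg fun _ => exp_neg_sub_one_add_nonneg _

theorem b_mul_le_phi (z : ℝ) : ψ.b * z ≤ ψ.phi z := by
  have := mul_nonneg ψ.c_nonneg (sq_nonneg z)
  have := ψ.jump_nonneg z
  unfold phi
  linarith

theorem continuousOn_phi : ContinuousOn ψ.phi (Set.Ici 0) := by
  intro z hz
  have hz : 0 ≤ z := hz
  refine ContinuousWithinAt.add (by fun_prop) ?_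
  refine continuousWithinAt_of_dominated
    (bound := fun u => (z + 1 + (z + 1) ^ 2) * min u (u ^ 2)) ?_ ?_
    (ψ.integrable_min.const_mul _) ?_
  · exact Eventually.of_forall fun w => by fun_prop
  · have h : ∀ᶠ w in 𝓝[Set.Ici 0] z, w < z + 1 :=
      nhdsWithin_le_nhds (eventually_lt_nhds (by linarith))
    filter_upwards [h, self_mem_nhdsWithin] with w hw hw0
    filter_upwards [ψ.ae_pos] with u hu
    rw [Real.norm_of_nonneg (exp_neg_sub_one_add_nonneg _)]
    exact exp_neg_sub_one_add_le_mul_min hw0 hw.le hu.le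
  · exact Eventually.of_forall fun u => by fun_prop

/-- The ratio `φ(z) / z` is nondecreasing, in product form. -/
theorem mul_phi_le_mul_phi {z w : ℝ} (hz : 0 ≤ z) (hzw : z ≤ w) :
    w * ψ.phi z ≤ z * ψ.phi w := by
  rcases hz.eq_or_lt with rfl | hz
  · simp [phi]
  have hw := hz.trans_le hzw
  have h : ∫ u, (Real.exp (-(z * u)) - 1 + z * u) ∂ψ.m ≤
      z / w * ∫ u, (Real.exp (-(w * u)) - 1 + w * u) ∂ψ.m := by
    rw [← integral_const_mul]
    refine integral_mono (ψ.integrable_jump hz.le) ((ψ.integrable_jump hw.le).const_mul _) ?_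
    intro u
    have h := exp_neg_sub_one_add_mul_le (div_nonneg hz.le hw.le) ((div_le_one hw).2 hzw) (w * u)
    have e : z / w * (w * u) = z * u := by field_simp
    rwa [e] at h
  have h' : w * ∫ u, (Real.exp (-(z * u)) - 1 + z * u) ∂ψ.m ≤
      z * ∫ u, (Real.exp (-(w * u)) - 1 + w * u) ∂ψ.m := by
    have := mul_le_mul_of_nonneg_left h hw.le
    rwa [← mul_assoc, mul_div_cancel₀ _ hw.ne'] at this
  have h2 : 0 ≤ ψ.c * (z * w * (w - z)) :=
    mul_nonneg ψ.c_nonneg (mul_nonneg (mul_nonneg hz.le hw.le) (sub_nonneg.2 hzw))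
  unfold phi
  nlinarith

variable {ψ}

theorem phi_nonneg (hb : 0 ≤ ψ.b) {z : ℝ} (hz : 0 ≤ z) : 0 ≤ ψ.phi z :=
  (mul_nonneg hb hz).trans (ψ.b_mul_le_phi z)

theorem phi_mono (hb : 0 ≤ ψ.b) {z w : ℝ} (hz : 0 ≤ z) (hzw : z ≤ w) : ψ.phi z ≤ ψ.phi w := by
  rcases (hz.trans hzw).eq_or_lt with rfl | hw
  · rw [le_antisymm hzw hz]
  · have h1 := ψ.mul_phi_le_mul_phi hz hzw
    have h2 := mul_le_mul_of_nonneg_right hzw (phi_nonneg hb hw.le)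
    exact le_of_mul_le_mul_left (h1.trans h2) hw

/-- In the (sub)critical case a zero of `φ` in `(0, ∞)` forces `b = c = 0` and `m = 0`, which
Grey's condition excludes. -/
theorem Grey.phi_pos (hG : ψ.Grey) (hb : 0 ≤ ψ.b) {z : ℝ} (hz : 0 < z) : 0 < ψ.phi z := by
  obtain ⟨θ, hθ, hpos, -⟩ := hG
  refine (phi_nonneg hb hz.le).lt_of_ne' fun h0 => (hpos θ le_rfl).ne' ?_
  have h1 : 0 ≤ ψ.b * z := mul_nonneg hb hz.le
  have h2 : 0 ≤ ψ.c * z ^ 2 := mul_nonneg ψ.c_nonneg (sq_nonneg z)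
  have h3 := ψ.jump_nonneg z
  have hsum := h0
  unfold phi at hsum
  have hb0 : ψ.b = 0 := by
    have : ψ.b * z = 0 := by linarith
    exact (mul_eq_zero.1 this).resolve_right hz.ne'
  have hc0 : ψ.c = 0 := by
    have : ψ.c * z ^ 2 = 0 := by linarith
    exact (mul_eq_zero.1 this).resolve_right (by positivity)
  have hj : ∫ u, (Real.exp (-(z * u)) - 1 + z * u) ∂ψ.m = 0 := by linarith
  rw [integral_eq_zero_iff_of_nonneg (fun _ => exp_neg_sub_one_add_nonneg _)
    (ψ.integrable_jump hz.le)] at hj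
  have hF : ∀ᵐ u ∂ψ.m, False := by
    filter_upwards [hj, ψ.ae_pos] with u hu hu0
    have := Real.add_one_lt_exp (x := -(z * u)) (by have := mul_pos hz hu0; linarith)
    simp only [Pi.zero_apply] at hu
    linarith
  have hm : ψ.m = 0 := by simpa using hF
  simp [phi, hb0, hc0, hm]

variable (ψ)

/-- `φ'(0+) = b`. -/
theorem tendsto_phi_div : Tendsto (fun z => ψ.phi z / z) (𝓝[>] 0) (𝓝 ψ.b) := by
  have hJ : Tendsto (fun z : ℝ => ∫ u, (Real.exp (-(z * u)) - 1 + z * u) / z ∂ψ.m) (𝓝[>] 0)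
      (𝓝 (∫ _, (0 : ℝ) ∂ψ.m)) := by
    refine tendsto_integral_filter_of_dominated_convergence (fun u => min u (u ^ 2)) ?_ ?_
      ψ.integrable_min ?_
    · exact Eventually.of_forall fun z => by fun_prop
    · have h : ∀ᶠ w : ℝ in 𝓝[>] 0, w < 1 := nhdsWithin_le_nhds (eventually_lt_nhds one_pos)
      filter_upwards [h, self_mem_nhdsWithin] with z hz1 hz
      have hz : 0 < z := hz
      filter_upwards [ψ.ae_pos] with u hu
      rw [Real.norm_of_nonneg (div_nonneg (exp_neg_sub_one_add_nonneg _) hz.le), div_le_iff₀ hz]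
      have hzu := mul_nonneg hz.le hu.le
      have h1 := exp_neg_sub_one_add_le_self hzu
      have h2 := exp_neg_sub_one_add_le_sq hzu
      rcases min_choice u (u ^ 2) with h | h <;> rw [h]
      · linarith
      · nlinarith [mul_nonneg hz.le (sq_nonneg u)]
    · filter_upwards [ψ.ae_pos] with u hu
      have hlim : Tendsto (fun z : ℝ => z * u ^ 2) (𝓝[>] 0) (𝓝 0) := by
        have : Tendsto (fun z : ℝ => z * u ^ 2) (𝓝 0) (𝓝 (0 * u ^ 2)) :=
          (continuous_id.mul continuous_const).tendsto 0
        rw [zero_mul] at this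
        exact this.mono_left nhdsWithin_le_nhds
      refine tendsto_of_tendsto_of_tendsto_of_le_of_le' tendsto_const_nhds hlim ?_ ?_
      · filter_upwards [self_mem_nhdsWithin] with z hz
        exact div_nonneg (exp_neg_sub_one_add_nonneg _) (le_of_lt hz)
      · filter_upwards [self_mem_nhdsWithin] with z hz
        have hz : 0 < z := hz
        rw [div_le_iff₀ hz]
        have h2 := exp_neg_sub_one_add_le_sq (mul_nonneg hz.le hu.le)
        nlinarith
  have hlin : Tendsto (fun z : ℝ => ψ.b + ψ.c * z) (𝓝[>] 0) (𝓝 (ψ.b + ψ.c * 0)) :=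
    ((continuous_const.add (continuous_const.mul continuous_id)).tendsto 0).mono_left
      nhdsWithin_le_nhds
  have := hlin.add hJ
  simp only [mul_zero, add_zero, integral_zero] at this
  refine this.congr' ?_
  filter_upwards [self_mem_nhdsWithin] with z hz
  have hz : z ≠ 0 := ne_of_gt hz
  rw [integral_div, phi]
  field_simp

end BranchingMechanism

/-! ### The cumulant semigroup -/

namespace BranchingMechanism

namespace IsCumulantSemigroup

variable {ψ : BranchingMechanism} {v : ℝ → ℝ → ℝ}

theorem apply_zero (hv : ψ.IsCumulantSemigroup v) {l : ℝ} (hl : 0 ≤ l) : v 0 l = l := by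
  simpa using hv.integral_eq 0 l le_rfl hl

theorem continuousOn_Icc (hv : ψ.IsCumulantSemigroup v) {T l : ℝ} (hT : 0 ≤ T) (hl : 0 ≤ l) :
    ContinuousOn (fun t => v t l) (Set.Icc 0 T) := by
  have hI := (intervalIntegrable_iff_integrableOn_Icc_of_le hT).1 (hv.intervalIntegrable T l hT hl)
  have h := intervalIntegral.continuousOn_primitive_interval (a := 0) (b := T)
    (f := fun s => ψ.phi (v s l)) (μ := volume) (by rwa [Set.uIcc_of_le hT])
  rw [Set.uIcc_of_le hT] at h
  exact ((continuousOn_const (c := l)).sub h).congr fun t ht => hv.integral_eq t l ht.1 hl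

/-- The integral equation in differential form, `∂ₜ vₜ(l) = -φ(vₜ(l))`. -/
theorem hasDerivAt (hv : ψ.IsCumulantSemigroup v) {t l : ℝ} (ht : 0 < t) (hl : 0 ≤ l) :
    HasDerivAt (fun s => v s l) (-ψ.phi (v t l)) t := by
  have hc : ContinuousOn (fun s => ψ.phi (v s l)) (Set.Ioi 0) := by
    refine ψ.continuousOn_phi.comp ?_ fun s hs => hv.nonneg s l (le_of_lt hs) hl
    intro s hs
    have hs : 0 < s := hs
    have := (hv.continuousOn_Icc (T := s + 1) (by linarith) hl).continuousAt
      (Icc_mem_nhds hs (by linarith))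
    exact this.continuousWithinAt
  have h := intervalIntegral.integral_hasDerivAt_right (hv.intervalIntegrable t l ht.le hl)
    (hc.stronglyMeasurableAtFilter isOpen_Ioi t ht) (hc.continuousAt (Ioi_mem_nhds ht))
  have h' := (hasDerivAt_const t l).sub h
  rw [zero_sub] at h'
  refine h'.congr_of_eventuallyEq ?_
  filter_upwards [Ioi_mem_nhds ht] with s hs
  exact hv.integral_eq s l (le_of_lt hs) hl

theorem antitone (hv : ψ.IsCumulantSemigroup v) (hb : 0 ≤ ψ.b) {s t l : ℝ} (hs : 0 ≤ s)
    (hst : s ≤ t) (hl : 0 ≤ l) : v t l ≤ v s l := by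
  have ht := hs.trans hst
  refine antitoneOn_of_deriv_nonpos (convex_Icc 0 t) (hv.continuousOn_Icc ht hl) ?_ ?_
    ⟨hs, hst⟩ ⟨ht, le_rfl⟩ hst
  · rw [interior_Icc]
    exact fun r hr => (hv.hasDerivAt hr.1 hl).differentiableAt.differentiableWithinAt
  · rw [interior_Icc]
    intro r hr
    rw [(hv.hasDerivAt hr.1 hl).deriv]
    linarith [phi_nonneg hb (hv.nonneg r l hr.1.le hl)]

theorem le_self (hv : ψ.IsCumulantSemigroup v) (hb : 0 ≤ ψ.b) {t l : ℝ} (ht : 0 ≤ t)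
    (hl : 0 ≤ l) : v t l ≤ l := by
  have := hv.antitone hb le_rfl ht hl
  rwa [hv.apply_zero hl] at this

theorem hasDerivAt_exp_mul (hv : ψ.IsCumulantSemigroup v) (k : ℝ) {t l : ℝ} (ht : 0 < t)
    (hl : 0 ≤ l) : HasDerivAt (fun s => Real.exp (k * s) * v s l)
      (Real.exp (k * t) * (k * v t l - ψ.phi (v t l))) t := by
  have h1 : HasDerivAt (fun s : ℝ => Real.exp (k * s)) (Real.exp (k * t) * k) t := by
    simpa using ((hasDerivAt_id t).const_mul k).exp
  exact (h1.mul (hv.hasDerivAt ht hl)).congr_deriv (by ring)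

theorem le_mul_exp (hv : ψ.IsCumulantSemigroup v) {t l : ℝ} (ht : 0 ≤ t) (hl : 0 ≤ l) :
    v t l ≤ l * Real.exp (-(ψ.b * t)) := by
  have hanti := antitoneOn_of_deriv_nonpos (convex_Icc 0 t)
    (f := fun s => Real.exp (ψ.b * s) * v s l)
    (ContinuousOn.mul (by fun_prop) (hv.continuousOn_Icc ht hl))
    (by
      rw [interior_Icc]
      exact fun r hr => (hv.hasDerivAt_exp_mul _ hr.1 hl).differentiableAt.differentiableWithinAt)
    (by
      rw [interior_Icc]
      intro r hr
      rw [(hv.hasDerivAt_exp_mul _ hr.1 hl).deriv]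
      exact mul_nonpos_of_nonneg_of_nonpos (Real.exp_nonneg _)
        (sub_nonpos.2 (ψ.b_mul_le_phi _)))
    (Set.left_mem_Icc.2 ht) (Set.right_mem_Icc.2 ht) ht
  simp only [mul_zero, Real.exp_zero, one_mul, hv.apply_zero hl] at hanti
  rw [Real.exp_neg, ← div_eq_mul_inv, le_div_iff₀ (Real.exp_pos _), mul_comm]
  exact hanti

/-- Since `vₛ(l) ≤ l` and `φ(z) / z` is nondecreasing, the solution decays no faster than at the
exponential rate `φ(l) / l`. -/
theorem mul_exp_le (hv : ψ.IsCumulantSemigroup v) (hb : 0 ≤ ψ.b) {t l : ℝ} (ht : 0 ≤ t)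
    (hl : 0 < l) : l * Real.exp (-(ψ.phi l / l * t)) ≤ v t l := by
  have hmono := monotoneOn_of_deriv_nonneg (convex_Icc 0 t)
    (f := fun s => Real.exp (ψ.phi l / l * s) * v s l)
    (ContinuousOn.mul (by fun_prop) (hv.continuousOn_Icc ht hl.le))
    (by
      rw [interior_Icc]
      exact fun r hr =>
        (hv.hasDerivAt_exp_mul _ hr.1 hl.le).differentiableAt.differentiableWithinAt)
    (by
      rw [interior_Icc]
      intro r hr
      rw [(hv.hasDerivAt_exp_mul _ hr.1 hl.le).deriv]
      refine mul_nonneg (Real.exp_nonneg _) (sub_nonneg.2 ?_)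
      have h := ψ.mul_phi_le_mul_phi (hv.nonneg r l hr.1.le hl.le) (hv.le_self hb hr.1.le hl.le)
      rw [div_mul_eq_mul_div, le_div_iff₀ hl]
      linarith)
    (Set.left_mem_Icc.2 ht) (Set.right_mem_Icc.2 ht) ht
  simp only [mul_zero, Real.exp_zero, one_mul, hv.apply_zero hl.le] at hmono
  rw [Real.exp_neg, ← div_eq_mul_inv, div_le_iff₀ (Real.exp_pos _), mul_comm]
  exact hmono

theorem pos (hv : ψ.IsCumulantSemigroup v) (hb : 0 ≤ ψ.b) {t l : ℝ} (ht : 0 ≤ t)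
    (hl : 0 < l) : 0 < v t l :=
  (mul_pos hl (Real.exp_pos _)).trans_le (hv.mul_exp_le hb ht hl)

theorem tendsto_div (hv : ψ.IsCumulantSemigroup v) (hb : 0 ≤ ψ.b) {t : ℝ} (ht : 0 ≤ t) :
    Tendsto (fun l => v t l / l) (𝓝[>] 0) (𝓝 (Real.exp (-(ψ.b * t)))) := by
  have hlow : Tendsto (fun l => Real.exp (-(ψ.phi l / l * t))) (𝓝[>] 0)
      (𝓝 (Real.exp (-(ψ.b * t)))) :=
    (Real.continuous_exp.tendsto _).comp ((ψ.tendsto_phi_div.mul_const t).neg)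
  refine tendsto_of_tendsto_of_tendsto_of_le_of_le' hlow tendsto_const_nhds ?_ ?_
  · filter_upwards [self_mem_nhdsWithin] with l hl
    have hl : 0 < l := hl
    rw [le_div_iff₀ hl, mul_comm]
    exact hv.mul_exp_le hb ht hl
  · filter_upwards [self_mem_nhdsWithin] with l hl
    have hl : 0 < l := hl
    rw [div_le_iff₀ hl, mul_comm]
    exact hv.le_mul_exp ht hl.le

/-- While `vₛ(l) ≥ z`, it decreases at speed at least `φ(z)`. -/
theorem lt_of_div_phi_lt (hv : ψ.IsCumulantSemigroup v) (hb : 0 ≤ ψ.b) {t l z : ℝ} (ht : 0 ≤ t)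
    (hl : 0 ≤ l) (hz : 0 < z) (hφ : 0 < ψ.phi z) (h : l / ψ.phi z < t) : v t l < z := by
  by_contra! hzv
  have h1 : (∫ _ in (0 : ℝ)..t, ψ.phi z) ≤ ∫ s in (0 : ℝ)..t, ψ.phi (v s l) := by
    refine intervalIntegral.integral_mono_on ht (by simp) (hv.intervalIntegrable t l ht hl) ?_
    intro s hs
    exact phi_mono hb hz.le (hzv.trans (hv.antitone hb hs.1 hs.2 hl))
  have h2 := hv.integral_eq t l ht hl
  rw [div_lt_iff₀ hφ] at h
  simp only [intervalIntegral.integral_const, sub_zero, smul_eq_mul] at h1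
  linarith

theorem tendsto_atTop (hv : ψ.IsCumulantSemigroup v) (hG : ψ.Grey) (hb : 0 ≤ ψ.b) {l : ℝ}
    (hl : 0 ≤ l) : Tendsto (fun t => v t l) atTop (𝓝 0) := by
  rw [tendsto_order]
  refine ⟨fun a ha => ?_, fun z hz => ?_⟩
  · filter_upwards [eventually_ge_atTop 0] with t ht
    exact ha.trans_le (hv.nonneg t l ht hl)
  · have hφ := hG.phi_pos hb hz
    filter_upwards [eventually_gt_atTop (l / ψ.phi z)] with t ht
    exact hv.lt_of_div_phi_lt hb ((div_nonneg hl hφ.le).trans ht.le) hl hz hφ ht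

/-- Separation of variables in the differential equation for `v`. -/
theorem integral_inv_phi (hv : ψ.IsCumulantSemigroup v) (hG : ψ.Grey) (hb : 0 ≤ ψ.b) {t l : ℝ}
    (ht : 0 ≤ t) (hl : 0 < l) : ∫ z in (v t l)..l, (ψ.phi z)⁻¹ = t := by
  have himg : (fun s => v s l) '' Set.uIcc 0 t ⊆ Set.Ioi 0 := by
    rw [Set.uIcc_of_le ht]
    rintro _ ⟨s, hs, rfl⟩
    exact hv.pos hb hs.1 hl
  have hφc : ContinuousOn ψ.phi (Set.Ioi 0) := ψ.continuousOn_phi.mono Set.Ioi_subset_Ici_self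
  have hvc := hv.continuousOn_Icc ht hl.le
  have h := intervalIntegral.integral_comp_mul_deriv'' (a := 0) (b := t) (f := fun s => v s l)
    (f' := fun s => -ψ.phi (v s l)) (g := fun z => (ψ.phi z)⁻¹)
    (by rwa [Set.uIcc_of_le ht])
    (by
      intro s hs
      rw [min_eq_left ht, max_eq_right ht] at hs
      exact (hv.hasDerivAt hs.1 hl.le).hasDerivWithinAt)
    (by
      rw [Set.uIcc_of_le ht]
      exact (ψ.continuousOn_phi.comp hvc fun s hs => hv.nonneg s l hs.1 hl.le).neg)
    ((hφc.inv₀ fun z hz => (hG.phi_pos hb hz).ne').mono himg)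
  have h' : ∫ s in (0 : ℝ)..t, ((fun z => (ψ.phi z)⁻¹) ∘ fun s => v s l) s * -ψ.phi (v s l)
      = ∫ _ in (0 : ℝ)..t, (-1 : ℝ) := by
    refine intervalIntegral.integral_congr fun s hs => ?_
    rw [Set.uIcc_of_le ht] at hs
    have := (hG.phi_pos hb (hv.pos hb hs.1 hl)).ne'
    simp [this]
  rw [h'] at h
  simp only [hv.apply_zero hl.le, intervalIntegral.integral_const, smul_eq_mul] at h
  rw [intervalIntegral.integral_symm, ← h]
  ring

/-- Grey's condition makes `vₜ(l)` bounded in `l`, for each `t > 0`. -/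
theorem bounded (hv : ψ.IsCumulantSemigroup v) (hG : ψ.Grey) (hb : 0 ≤ ψ.b) {t : ℝ}
    (ht : 0 < t) : ∃ K, ∀ l, 0 ≤ l → v t l ≤ K := by
  have hG' := hG
  obtain ⟨θ, hθ, -, hint⟩ := hG'
  -- the tails of the convergent integral of `1 / φ` are eventually below `t`
  have htail := intervalIntegral_tendsto_integral_Ioi θ hint tendsto_id
  obtain ⟨K, hKt, hK⟩ := ((htail.eventually
    (lt_mem_nhds (sub_lt_self (∫ z in Set.Ioi θ, (ψ.phi z)⁻¹) ht))).and
      (eventually_ge_atTop θ)).exists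
  refine ⟨K, fun l hl => ?_⟩
  by_contra! hlt
  have hvl := hv.le_self hb ht.le hl
  have hl0 : 0 < l := by linarith
  have hsep := hv.integral_inv_phi hG hb ht.le hl0
  have hII : ∀ a c, θ ≤ a → a ≤ c → IntervalIntegrable (fun z => (ψ.phi z)⁻¹) volume a c :=
    fun a c ha hac => (intervalIntegrable_iff_integrableOn_Ioc_of_le hac).2
      (hint.mono_set fun z hz => lt_of_le_of_lt ha hz.1)
  have h1 : ∫ z in θ..l, (ψ.phi z)⁻¹ ≤ ∫ z in Set.Ioi θ, (ψ.phi z)⁻¹ := by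
    rw [intervalIntegral.integral_of_le (by linarith)]
    refine setIntegral_mono_set hint ?_ (Eventually.of_forall fun z hz => hz.1)
    filter_upwards [ae_restrict_mem measurableSet_Ioi] with z hz
    exact inv_nonneg.2 (phi_nonneg hb (hθ.trans hz).le)
  have h2 := intervalIntegral.integral_add_adjacent_intervals (hII θ K le_rfl hK)
    (hII K (v t l) hK hlt.le)
  have h3 := intervalIntegral.integral_add_adjacent_intervals
    (hII θ (v t l) le_rfl (hK.trans hlt.le)) (hII (v t l) l (hK.trans hlt.le) hvl)
  have h4 : 0 ≤ ∫ z in K..(v t l), (ψ.phi z)⁻¹ :=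
    intervalIntegral.integral_nonneg hlt.le fun z hz =>
      inv_nonneg.2 (phi_nonneg hb (by linarith [hz.1]))
  simp only [id] at hKt
  linarith

end IsCumulantSemigroup

end BranchingMechanism

/-! ### Elementary facts on `1 - e^{-z}` -/

theorem one_sub_exp_neg_le (z : ℝ) : 1 - Real.exp (-z) ≤ z := by
  linarith [Real.add_one_le_exp (-z)]

theorem one_sub_exp_neg_nonneg {z : ℝ} (hz : 0 ≤ z) : 0 ≤ 1 - Real.exp (-z) :=
  sub_nonneg.2 (Real.exp_le_one_iff.2 (neg_nonpos.2 hz))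

theorem abs_exp_neg_mul_le_one {a b : ℝ} (ha : 0 ≤ a) (hb : 0 ≤ b) :
    |Real.exp (-(a * b))| ≤ 1 := by
  rw [abs_of_pos (Real.exp_pos _), Real.exp_le_one_iff, neg_nonpos]
  exact mul_nonneg ha hb

theorem tendsto_one_sub_exp_neg_mul_div (y : ℝ) :
    Tendsto (fun a => (1 - Real.exp (-(y * a))) / a) (𝓝[>] 0) (𝓝 y) := by
  have h : HasDerivAt (fun a => 1 - Real.exp (-(y * a))) y 0 := by
    have := (((hasDerivAt_id (0 : ℝ)).const_mul y).neg.exp).const_sub 1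
    simpa using this
  have h2 := hasDerivAt_iff_tendsto_slope.1 h
  have h3 := h2.mono_left (nhdsWithin_mono (0 : ℝ) fun a (ha : 0 < a) => ha.ne')
  refine h3.congr fun a => ?_
  simp [slope_def_field]

/-! ### Atoms at zero of the transition kernels -/

/-- The Laplace transform at infinity is the mass of `{0}`. -/
theorem tendsto_laplace_nat (μ : Measure ℝ≥0) [IsFiniteMeasure μ] :
    Tendsto (fun n : ℕ => ∫ y : ℝ≥0, Real.exp (-((n : ℝ) * (y : ℝ))) ∂μ) atTop
      (𝓝 (μ.real {0})) := by
  have h : ∫ y : ℝ≥0, Set.indicator {0} (1 : ℝ≥0 → ℝ) y ∂μ = μ.real {0} :=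
    integral_indicator_one (measurableSet_singleton 0)
  rw [← h]
  refine tendsto_integral_of_dominated_convergence (fun _ => (1 : ℝ)) ?_ (integrable_const _) ?_ ?_
  · exact fun n => by fun_prop
  · exact fun n => Eventually.of_forall fun y =>
      abs_exp_neg_mul_le_one n.cast_nonneg y.coe_nonneg
  · refine Eventually.of_forall fun y => ?_
    rcases eq_or_ne y 0 with rfl | hy
    · simp
    · have hy' : (0 : ℝ) < y := by positivity
      simp only [Set.mem_singleton_iff, hy, not_false_eq_true, Set.indicator_of_notMem]
      exact Real.tendsto_exp_neg_atTop_nhds_zero.comp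
        (tendsto_natCast_atTop_atTop.atTop_mul_const hy')

/-- The Laplace transform of `Q_t(x, ·)` is `l ↦ e^{-x v_t(l)}`. -/
def HasLaplaceExponent (Q : ℝ≥0 → Kernel ℝ≥0 ℝ≥0) (v : ℝ → ℝ → ℝ) : Prop :=
  ∀ t x l : ℝ≥0,
    ∫ y : ℝ≥0, Real.exp (-((l : ℝ) * (y : ℝ))) ∂(Q t x) = Real.exp (-((x : ℝ) * v t l))

/-- The limit `v̄_r` of `v_r(l)` as `l → ∞`, read off from `Q_r(1, {0}) = e^{-v̄_r}`. It is
meaningful for `r > 0` under Grey's condition. -/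
noncomputable def extinctionExponent (Q : ℝ≥0 → Kernel ℝ≥0 ℝ≥0) (r : ℝ≥0) : ℝ :=
  -Real.log ((Q r 1).real {0})

namespace BranchingMechanism

variable {ψ : BranchingMechanism} {Q : ℝ≥0 → Kernel ℝ≥0 ℝ≥0} {v : ℝ → ℝ → ℝ}
  [∀ t, IsMarkovKernel (Q t)]

namespace IsCumulantSemigroup

theorem tendsto_extinctionExponent (hv : ψ.IsCumulantSemigroup v) (hG : ψ.Grey) (hb : 0 ≤ ψ.b)
    (hL : HasLaplaceExponent Q v)
    {r : ℝ≥0} (hr : 0 < r) :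
    Tendsto (fun n : ℕ => v r n) atTop (𝓝 (extinctionExponent Q r)) := by
  have hlim := tendsto_laplace_nat (Q r 1)
  have hE : ∀ n : ℕ, ∫ y : ℝ≥0, Real.exp (-((n : ℝ) * (y : ℝ))) ∂(Q r 1)
      = Real.exp (-v r n) := fun n => by simpa using hL r 1 n
  simp only [hE] at hlim
  obtain ⟨K, hK⟩ := hv.bounded hG hb (t := r) (by exact_mod_cast hr)
  have hp : Real.exp (-K) ≤ (Q r 1).real {0} :=
    ge_of_tendsto' hlim fun n => Real.exp_le_exp.2 (neg_le_neg (hK n n.cast_nonneg))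
  have h := (hlim.log ((Real.exp_pos _).trans_le hp).ne').neg
  simpa [extinctionExponent] using h

theorem real_singleton_zero (hv : ψ.IsCumulantSemigroup v) (hG : ψ.Grey) (hb : 0 ≤ ψ.b)
    (hL : HasLaplaceExponent Q v)
    {r : ℝ≥0} (hr : 0 < r) (y : ℝ≥0) :
    (Q r y).real {0} = Real.exp (-((y : ℝ) * extinctionExponent Q r)) := by
  have hlim := tendsto_laplace_nat (Q r y)
  have hE : ∀ n : ℕ, ∫ z : ℝ≥0, Real.exp (-((n : ℝ) * (z : ℝ))) ∂(Q r y)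
      = Real.exp (-((y : ℝ) * v r n)) := fun n => by simpa using hL r y n
  simp only [hE] at hlim
  exact tendsto_nhds_unique hlim ((Real.continuous_exp.tendsto _).comp
    ((hv.tendsto_extinctionExponent hG hb hL hr).const_mul (y : ℝ)).neg)

theorem extinctionExponent_pos (hv : ψ.IsCumulantSemigroup v) (hG : ψ.Grey) (hb : 0 ≤ ψ.b)
    (hL : HasLaplaceExponent Q v)
    {r : ℝ≥0} (hr : 0 < r) : 0 < extinctionExponent Q r := by
  refine (hv.pos hb r.coe_nonneg one_pos).trans_le ?_
  refine ge_of_tendsto (hv.tendsto_extinctionExponent hG hb hL hr) ?_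
  filter_upwards [eventually_ge_atTop 1] with n hn
  have h1 := hL r 1 1
  have h2 := hL r 1 n
  have h3 : ∫ y : ℝ≥0, Real.exp (-(((n : ℝ≥0) : ℝ) * (y : ℝ))) ∂(Q r 1) ≤
      ∫ y : ℝ≥0, Real.exp (-(((1 : ℝ≥0) : ℝ) * (y : ℝ))) ∂(Q r 1) := by
    refine integral_mono ?_ ?_ ?_
    · exact Integrable.of_bound (by fun_prop) 1 (Eventually.of_forall fun y =>
        abs_exp_neg_mul_le_one (NNReal.coe_nonneg _) y.coe_nonneg)
    · exact Integrable.of_bound (by fun_prop) 1 (Eventually.of_forall fun y =>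
        abs_exp_neg_mul_le_one (NNReal.coe_nonneg _) y.coe_nonneg)
    · intro y
      refine Real.exp_le_exp.2 (neg_le_neg (mul_le_mul_of_nonneg_right ?_ y.coe_nonneg))
      exact_mod_cast hn
  rw [h1, h2, Real.exp_le_exp] at h3
  simpa using h3

end IsCumulantSemigroup

end BranchingMechanism

/-! ### The Markov property and absorption at zero -/

namespace IsCadlagMarkov

variable {Ω : Type*} {mΩ : MeasurableSpace Ω} {Q : ℝ≥0 → Kernel ℝ≥0 ℝ≥0}
  {ℱ : Filtration ℝ≥0 mΩ} {X : ℝ≥0 → Ω → ℝ≥0} {P : Measure Ω} {x : ℝ≥0}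

theorem measurable (hX : IsCadlagMarkov Q ℱ X P x) (t : ℝ≥0) : Measurable (X t) :=
  (hX.adapted t).mono (ℱ.le t) le_rfl

theorem integral_mul_comp [IsProbabilityMeasure P] (hX : IsCadlagMarkov Q ℱ X P x) (s t : ℝ≥0)
    {F : Ω → ℝ} (hF : Measurable[ℱ s] F) (hFb : ∃ C, ∀ ω, |F ω| ≤ C)
    {f : ℝ≥0 → ℝ} (hf : Measurable f) (hfb : ∃ C, ∀ y, |f y| ≤ C) :
    ∫ ω, F ω * f (X (s + t) ω) ∂P = ∫ ω, F ω * ∫ y, f y ∂(Q t (X s ω)) ∂P := by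
  obtain ⟨C, hC⟩ := hFb
  obtain ⟨D, hD⟩ := hfb
  have hfX : Measurable fun ω => f (X (s + t) ω) := hf.comp (hX.measurable _)
  have hint : Integrable (fun ω => f (X (s + t) ω)) P :=
    Integrable.of_bound hfX.aestronglyMeasurable D (Eventually.of_forall fun ω => hD _)
  have hint2 : Integrable (F * fun ω => f (X (s + t) ω)) P :=
    hint.bdd_mul (hF.mono (ℱ.le s) le_rfl).aestronglyMeasurable
      (Eventually.of_forall fun ω => hC ω)
  have h1 := condExp_mul_of_stronglyMeasurable_left hF.stronglyMeasurable hint2 hint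
  have h2 := hX.markov s t f hf ⟨D, hD⟩
  calc ∫ ω, F ω * f (X (s + t) ω) ∂P
      = ∫ ω, (P[F * (fun ω => f (X (s + t) ω)) | ℱ s]) ω ∂P := (integral_condExp (ℱ.le s)).symm
    _ = _ := by
        refine integral_congr_ae ?_
        filter_upwards [h1, h2] with ω h1 h2
        rw [h1, Pi.mul_apply, h2]

theorem map_eq [IsProbabilityMeasure P] [∀ t, IsMarkovKernel (Q t)]
    (hX : IsCadlagMarkov Q ℱ X P x) (t : ℝ≥0) : P.map (X t) = Q t x := by
  have : IsProbabilityMeasure (P.map (X t)) :=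
    Measure.isProbabilityMeasure_map (hX.measurable t).aemeasurable
  ext S hS
  have h := hX.integral_mul_comp 0 t (F := fun _ => 1) measurable_const ⟨1, by simp⟩
    (f := S.indicator 1) (measurable_one.indicator hS) ⟨1, fun y => by
      by_cases hy : y ∈ S <;> simp [hy]⟩
  simp only [one_mul, zero_add] at h
  have h2 : ∫ ω, ∫ y, S.indicator (1 : ℝ≥0 → ℝ) y ∂(Q t (X 0 ω)) ∂P = (Q t x).real S := by
    calc _ = ∫ ω, (Q t x).real S ∂P := by
          refine integral_congr_ae ?_
          filter_upwards [hX.initial] with ω hω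
          rw [hω, integral_indicator_one hS]
      _ = _ := by simp
  have h3 : ∫ ω, S.indicator (1 : ℝ≥0 → ℝ) (X t ω) ∂P = (P.map (X t)).real S := by
    rw [← integral_indicator_one hS, integral_map (hX.measurable t).aemeasurable]
    exact (measurable_one.indicator hS).aestronglyMeasurable
  rw [h3, h2] at h
  rwa [measureReal_def, measureReal_def, ENNReal.toReal_eq_toReal_iff' (measure_ne_top _ _)
    (measure_ne_top _ _)] at h

theorem integral_comp [IsProbabilityMeasure P] [∀ t, IsMarkovKernel (Q t)]
    (hX : IsCadlagMarkov Q ℱ X P x) (t : ℝ≥0) {f : ℝ≥0 → ℝ} (hf : Measurable f) :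
    ∫ ω, f (X t ω) ∂P = ∫ y, f y ∂(Q t x) := by
  rw [← hX.map_eq t, integral_map (hX.measurable t).aemeasurable hf.aestronglyMeasurable]

end IsCadlagMarkov

section Absorption

variable {Ω : Type*} {mΩ : MeasurableSpace Ω} {Q : ℝ≥0 → Kernel ℝ≥0 ℝ≥0}
  {ℱ : Filtration ℝ≥0 mΩ} {X : ℝ≥0 → Ω → ℝ≥0} {P : Measure Ω} {x : ℝ≥0}
  {ψ : BranchingMechanism} {v : ℝ → ℝ → ℝ}

theorem abs_one_sub_exp_neg_le_one (y : ℝ≥0) : |1 - Real.exp (-(y : ℝ))| ≤ 1 := by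
  rw [abs_of_nonneg (one_sub_exp_neg_nonneg y.coe_nonneg)]
  linarith [Real.exp_pos (-(y : ℝ))]

theorem integrable_one_sub_exp_neg [IsProbabilityMeasure P] {Y : Ω → ℝ≥0} (hY : Measurable Y) :
    Integrable (fun ω => 1 - Real.exp (-(Y ω : ℝ))) P :=
  Integrable.of_bound (by fun_prop) 1 (Eventually.of_forall fun ω => abs_one_sub_exp_neg_le_one _)

/-- A maximal inequality on a finite set of times: once the process is below `ε`, the expectation
of `1 - e^{-X}` stays below `ε`. The event is split according to the first time `d` of `T` with
`X_d < ε`, and the Markov property is applied at `d`. -/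
theorem setIntegral_exists_lt_le [IsProbabilityMeasure P] [∀ t, IsMarkovKernel (Q t)]
    (hb : 0 ≤ ψ.b) (hv : ψ.IsCumulantSemigroup v)
    (hL : HasLaplaceExponent Q v)
    (hX : IsCadlagMarkov Q ℱ X P x) {s : ℝ≥0} (T : Finset ℝ≥0) (hT : ∀ d ∈ T, d ≤ s) (ε : ℝ≥0) :
    ∫ ω in {ω | ∃ d ∈ T, X d ω < ε}, (1 - Real.exp (-(X s ω : ℝ))) ∂P ≤ ε := by
  let A : ℝ≥0 → Set Ω := fun d => {ω | X d ω < ε ∧ ∀ e ∈ T, e < d → ε ≤ X e ω}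
  have hAm : ∀ d, MeasurableSet[ℱ d] (A d) := by
    intro d
    have h1 : MeasurableSet[ℱ d] {ω | X d ω < ε} := hX.adapted d measurableSet_Iio
    have h2 : MeasurableSet[ℱ d] {ω | ∀ e ∈ T, e < d → ε ≤ X e ω} := by
      have : {ω | ∀ e ∈ T, e < d → ε ≤ X e ω} =
          ⋂ e ∈ T.filter (· < d), {ω | ε ≤ X e ω} := by
        ext ω; simp
      rw [this]
      refine Finset.measurableSet_biInter _ fun e he => ?_
      exact ℱ.mono (Finset.mem_filter.1 he).2.le _ (hX.adapted e measurableSet_Ici)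
    exact h1.inter h2
  have hAm' : ∀ d, MeasurableSet (A d) := fun d => ℱ.le d _ (hAm d)
  have hU : {ω | ∃ d ∈ T, X d ω < ε} = ⋃ d ∈ T, A d := by
    ext ω
    simp only [Set.mem_ofPred_eq, Set.mem_iUnion, exists_prop]
    constructor
    · rintro ⟨d, hd, hlt⟩
      have hne : (T.filter fun e => X e ω < ε).Nonempty :=
        ⟨d, Finset.mem_filter.2 ⟨hd, hlt⟩⟩
      have hm := Finset.mem_filter.1 (Finset.min'_mem _ hne)
      refine ⟨_, hm.1, hm.2, fun e he hlt' => ?_⟩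
      by_contra! hcon
      exact absurd (Finset.min'_le _ e (Finset.mem_filter.2 ⟨he, hcon⟩)) (not_le.2 hlt')
    · rintro ⟨d, hd, h, -⟩
      exact ⟨d, hd, h⟩
  have hdisj : Set.PairwiseDisjoint (T : Set ℝ≥0) A := by
    intro d hd e he hde
    refine Set.disjoint_left.2 fun ω h1 h2 => ?_
    rcases lt_or_gt_of_ne hde with h | h
    · exact absurd h1.1 (not_lt.2 (h2.2 d hd h))
    · exact absurd h2.1 (not_lt.2 (h1.2 e he h))
  have hstep : ∀ d ∈ T, ∫ ω in A d, (1 - Real.exp (-(X s ω : ℝ))) ∂P ≤ ε * P.real (A d) := by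
    intro d hd
    have hM := hX.integral_mul_comp d (s - d) (F := (A d).indicator 1)
      (stronglyMeasurable_one.indicator (hAm d)).measurable
      ⟨1, fun ω => by by_cases h : ω ∈ A d <;> simp [h]⟩
      (f := fun y => 1 - Real.exp (-(y : ℝ))) (by fun_prop) ⟨1, abs_one_sub_exp_neg_le_one⟩
    rw [add_tsub_cancel_of_le (hT d hd)] at hM
    have hkey : ∀ y : ℝ≥0, ∫ z : ℝ≥0, (1 - Real.exp (-(z : ℝ))) ∂(Q (s - d) y) ≤ y := by
      intro y
      have h := hL (s - d) y 1
      simp only [NNReal.coe_one, one_mul] at h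
      rw [integral_sub (integrable_const _), h]
      · simp only [integral_const, probReal_univ, smul_eq_mul, mul_one]
        have h1 := one_sub_exp_neg_le ((y : ℝ) * v ((s - d : ℝ≥0) : ℝ) 1)
        have h2 := hv.le_self hb (s - d).coe_nonneg zero_le_one
        nlinarith [mul_le_mul_of_nonneg_left h2 y.coe_nonneg]
      · exact Integrable.of_bound (by fun_prop) 1 (Eventually.of_forall fun z => by
          rw [Real.norm_eq_abs, abs_of_pos (Real.exp_pos _), Real.exp_le_one_iff]
          exact neg_nonpos.2 z.coe_nonneg)
    calc ∫ ω in A d, (1 - Real.exp (-(X s ω : ℝ))) ∂P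
        = ∫ ω, (A d).indicator 1 ω * (1 - Real.exp (-(X s ω : ℝ))) ∂P := by
          rw [← integral_indicator (hAm' d)]
          congr 1 with ω
          by_cases h : ω ∈ A d <;> simp [h]
      _ = _ := hM
      _ ≤ ∫ ω, (A d).indicator (fun _ => (ε : ℝ)) ω ∂P := by
          refine integral_mono_of_nonneg ?_ ((integrable_const _).indicator (hAm' d)) ?_
          · refine Eventually.of_forall fun ω => mul_nonneg ?_ ?_
            · exact Set.indicator_nonneg (fun _ _ => zero_le_one) _
            · exact integral_nonneg fun z => one_sub_exp_neg_nonneg z.coe_nonneg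
          · refine Eventually.of_forall fun ω => ?_
            by_cases h : ω ∈ A d
            · have hlt : (X d ω : ℝ) ≤ ε := by exact_mod_cast h.1.le
              simpa [h] using (hkey (X d ω)).trans hlt
            · simp [h]
      _ = ε * P.real (A d) := by
          rw [integral_indicator (hAm' d)]
          simp [mul_comm]
  have hI := integrable_one_sub_exp_neg (P := P) (hX.measurable s)
  rw [hU, integral_biUnion_finset T (fun d _ => hAm' d) hdisj fun d _ => hI.integrableOn]
  calc _ ≤ ∑ d ∈ T, ε * P.real (A d) := Finset.sum_le_sum hstep
    _ = ε * P.real (⋃ d ∈ T, A d) := by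
        rw [← Finset.mul_sum, measureReal_biUnion_finset hdisj fun d _ => hAm' d]
    _ ≤ ε * 1 := by gcongr; exact measureReal_le_one
    _ = ε := mul_one _

/-- Zero is a trap. By right continuity, a path vanishing before time `s` takes arbitrarily small
values on a countable dense set of times before `s`, so the maximal inequality applies. -/
theorem ae_eq_zero_of_exists_eq_zero [IsProbabilityMeasure P] [∀ t, IsMarkovKernel (Q t)]
    (hb : 0 ≤ ψ.b) (hv : ψ.IsCumulantSemigroup v)
    (hL : HasLaplaceExponent Q v)
    (hX : IsCadlagMarkov Q ℱ X P x) (s : ℝ≥0) :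
    ∀ᵐ ω ∂P, (∃ r ≤ s, X r ω = 0) → X s ω = 0 := by
  let q : ℕ → ℝ≥0 := fun k => min s (TopologicalSpace.denseSeq ℝ≥0 k)
  let B : ℝ≥0 → ℕ → Set Ω := fun ε n => {ω | ∃ d ∈ (Finset.range n).image q, X d ω < ε}
  have hBm : ∀ ε n, MeasurableSet (B ε n) := by
    intro ε n
    have : B ε n = ⋃ d ∈ (Finset.range n).image q, {ω | X d ω < ε} := by
      ext ω; simp [B]
    rw [this]
    exact Finset.measurableSet_biUnion _ fun d _ => hX.measurable d measurableSet_Iio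
  have hBmono : ∀ ε, Monotone (B ε) := by
    rintro ε m n hmn ω ⟨d, hd, h⟩
    exact ⟨d, Finset.image_subset_image (Finset.range_mono hmn) hd, h⟩
  have hI := integrable_one_sub_exp_neg (P := P) (hX.measurable s)
  have hBU : ∀ ε : ℝ≥0, ∫ ω in ⋃ n, B ε n, (1 - Real.exp (-(X s ω : ℝ))) ∂P ≤ ε := by
    intro ε
    refine le_of_tendsto' (tendsto_setIntegral_of_monotone (hBm ε) (hBmono ε) hI.integrableOn)
      fun n => setIntegral_exists_lt_le hb hv hL hX _ ?_ ε
    intro d hd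
    obtain ⟨k, -, rfl⟩ := Finset.mem_image.1 hd
    exact min_le_left _ _
  let C : Set Ω := ⋂ k : ℕ, ⋃ n, B (1 / (k + 1)) n
  have hCm : MeasurableSet C := MeasurableSet.iInter fun k => MeasurableSet.iUnion fun n => hBm _ n
  have hnn : ∀ ω, 0 ≤ 1 - Real.exp (-(X s ω : ℝ)) := fun ω =>
    one_sub_exp_neg_nonneg (X s ω).coe_nonneg
  have hC0 : ∫ ω in C, (1 - Real.exp (-(X s ω : ℝ))) ∂P = 0 := by
    refine le_antisymm (ge_of_tendsto' (tendsto_one_div_add_atTop_nhds_zero_nat (𝕜 := ℝ))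
      fun k => ?_) (integral_nonneg fun ω => hnn ω)
    refine (setIntegral_mono_set hI.integrableOn (Eventually.of_forall fun ω => hnn ω)
      (Eventually.of_forall (Set.iInter_subset _ k))).trans ((hBU _).trans (by simp))
  rw [setIntegral_eq_zero_iff_of_nonneg_ae (Eventually.of_forall fun ω => hnn ω)
    hI.integrableOn] at hC0
  have hC0' := (ae_restrict_iff' hCm).1 hC0
  filter_upwards [hC0'] with ω hω
  rintro ⟨r, hrs, hr0⟩
  rcases hrs.eq_or_lt with rfl | hrs
  · exact hr0
  have hωC : ω ∈ C := by
    refine Set.mem_iInter.2 fun k => ?_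
    have hpos : (0 : ℝ≥0) < 1 / (k + 1) := by positivity
    have hrc := hX.right_continuous ω r
    have hev : ∀ᶠ u in 𝓝[≥] r, X u ω < 1 / (k + 1) :=
      hrc.eventually (gt_mem_nhds (show X r ω < 1 / (k + 1) by rwa [hr0]))
    obtain ⟨u, hu, hsub⟩ := (mem_nhdsGE_iff_exists_Ico_subset' hrs).1 hev
    obtain ⟨n, hd⟩ := (TopologicalSpace.denseRange_denseSeq ℝ≥0).exists_mem_open isOpen_Ioo
      (Set.nonempty_Ioo.2 (lt_min hu hrs))
    refine Set.mem_iUnion.2 ⟨n + 1, TopologicalSpace.denseSeq ℝ≥0 n,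
      Finset.mem_image.2 ⟨n, by simp, ?_⟩, ?_⟩
    · exact min_eq_right (hd.2.le.trans (min_le_right _ _))
    · exact hsub ⟨hd.1.le, hd.2.trans_le (min_le_left _ _)⟩
  have h := hω hωC
  simp only [Pi.zero_apply] at h
  have h1 : Real.exp (-(X s ω : ℝ)) = 1 := by linarith
  rw [Real.exp_eq_one_iff, neg_eq_zero] at h1
  exact_mod_cast h1

theorem mem_survival_iff (hX : IsCadlagMarkov Q ℱ X P x) (s : ℝ≥0) (ω : Ω) :
    ω ∈ survival X s ↔ ∀ r ≤ s, X r ω ≠ 0 := by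
  constructor
  · intro h r hr h0
    have h1 : extinctionTime X ω ≤ r := iInf₂_le r h0
    have h2 : (r : ℝ≥0∞) ≤ s := by exact_mod_cast hr
    exact absurd (lt_of_lt_of_le h (h1.trans h2)) (lt_irrefl _)
  · intro h
    -- right continuity at `s` keeps the path away from zero a little beyond `s`
    have hev : ∀ᶠ u in 𝓝[≥] s, X u ω ≠ 0 :=
      (hX.right_continuous ω s).eventually (isOpen_ne.mem_nhds (h s le_rfl))
    obtain ⟨u, hu, hsub⟩ := (mem_nhdsGE_iff_exists_Ico_subset' (lt_add_one s)).1 hev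
    have hu : s < u := hu
    refine lt_of_lt_of_le (ENNReal.coe_lt_coe.2 hu) (le_iInf₂ fun r hr => ?_)
    by_contra! hlt
    have hlt : r < u := by exact_mod_cast hlt
    rcases le_total r s with hrs | hrs
    · exact h r hrs hr
    · exact hsub ⟨hrs, hlt⟩ hr

theorem survival_ae_eq [IsProbabilityMeasure P] [∀ t, IsMarkovKernel (Q t)]
    (hb : 0 ≤ ψ.b) (hv : ψ.IsCumulantSemigroup v)
    (hL : HasLaplaceExponent Q v)
    (hX : IsCadlagMarkov Q ℱ X P x) (s : ℝ≥0) :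
    survival X s =ᵐ[P] {ω | X s ω ≠ 0} := by
  filter_upwards [ae_eq_zero_of_exists_eq_zero hb hv hL hX s] with ω hω
  refine propext ⟨fun h => (mem_survival_iff hX s ω).1 h s le_rfl, fun h => ?_⟩
  refine (mem_survival_iff hX s ω).2 fun r hr h0 => h (hω ⟨r, hr, h0⟩)

end Absorption

/-! ### The limit of the conditional laws -/

section Limit

variable {Ω : Type*} {mΩ : MeasurableSpace Ω} {Q : ℝ≥0 → Kernel ℝ≥0 ℝ≥0}
  {ℱ : Filtration ℝ≥0 mΩ} {X : ℝ≥0 → Ω → ℝ≥0} {P : Measure Ω} {x : ℝ≥0}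
  {ψ : BranchingMechanism} {v : ℝ → ℝ → ℝ}

theorem integral_exp_neg [IsProbabilityMeasure P] [∀ t, IsMarkovKernel (Q t)]
    (hL : HasLaplaceExponent Q v)
    (hX : IsCadlagMarkov Q ℱ X P x) (t : ℝ≥0) {l : ℝ} (hl : 0 ≤ l) :
    ∫ ω, Real.exp (-((X t ω : ℝ) * l)) ∂P = Real.exp (-((x : ℝ) * v t l)) := by
  lift l to ℝ≥0 using hl
  rw [← hL t x l, ← hX.integral_comp t (by fun_prop)]
  simp_rw [mul_comm]

theorem integrable_exp_neg [IsProbabilityMeasure P] {Y : Ω → ℝ≥0} (hY : Measurable Y) {l : ℝ}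
    (hl : 0 ≤ l) : Integrable (fun ω => Real.exp (-((Y ω : ℝ) * l))) P :=
  Integrable.of_bound (by fun_prop) 1
    (Eventually.of_forall fun ω => abs_exp_neg_mul_le_one (Y ω).coe_nonneg hl)

/-- `E[X_t] < ∞`, by Fatou's lemma applied to `(1 - e^{-a X_t}) / a` as `a → 0`, whose expectation
is at most `x v_t(a) / a ≤ x`. -/
theorem integrable_process [IsProbabilityMeasure P] [∀ t, IsMarkovKernel (Q t)]
    (hb : 0 ≤ ψ.b) (hv : ψ.IsCumulantSemigroup v)
    (hL : HasLaplaceExponent Q v)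
    (hX : IsCadlagMarkov Q ℱ X P x) (t : ℝ≥0) : Integrable (fun ω => (X t ω : ℝ)) P := by
  have hXm := hX.measurable t
  refine ⟨by fun_prop, ?_⟩
  rw [hasFiniteIntegral_iff_ofReal (Eventually.of_forall fun ω => (X t ω).coe_nonneg)]
  let a : ℕ → ℝ := fun n => 1 / ((n : ℝ) + 1)
  have ha : ∀ n, 0 < a n := fun n => by positivity
  have halim : Tendsto a atTop (𝓝[>] 0) :=
    tendsto_nhdsWithin_iff.2 ⟨tendsto_one_div_add_atTop_nhds_zero_nat, Eventually.of_forall ha⟩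
  have hlim : ∀ ω, Tendsto
      (fun n => ENNReal.ofReal ((1 - Real.exp (-((X t ω : ℝ) * a n))) / a n)) atTop
      (𝓝 (ENNReal.ofReal (X t ω))) := fun ω =>
    (ENNReal.continuous_ofReal.tendsto _).comp
      ((tendsto_one_sub_exp_neg_mul_div (X t ω)).comp halim)
  have hbound : ∀ n,
      ∫⁻ ω, ENNReal.ofReal ((1 - Real.exp (-((X t ω : ℝ) * a n))) / a n) ∂P
        ≤ ENNReal.ofReal x := by
    intro n
    have hi := integrable_exp_neg (P := P) hXm (ha n).le
    have hi' : Integrable (fun ω => (1 - Real.exp (-((X t ω : ℝ) * a n))) / a n) P :=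
      ((integrable_const _).sub hi).div_const _
    rw [← ofReal_integral_eq_lintegral_ofReal hi']
    · refine ENNReal.ofReal_le_ofReal ?_
      rw [integral_div, integral_sub (integrable_const _) hi, integral_exp_neg hL hX t (ha n).le]
      simp only [integral_const, probReal_univ, smul_eq_mul, mul_one]
      rw [div_le_iff₀ (ha n)]
      have h1 := one_sub_exp_neg_le ((x : ℝ) * v t (a n))
      have h2 := hv.le_self hb t.coe_nonneg (ha n).le
      nlinarith [mul_le_mul_of_nonneg_left h2 x.coe_nonneg]
    · exact Eventually.of_forall fun ω => div_nonneg
        (one_sub_exp_neg_nonneg (mul_nonneg (X t ω).coe_nonneg (ha n).le)) (ha n).le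
  calc ∫⁻ ω, ENNReal.ofReal (X t ω) ∂P
      = ∫⁻ ω, liminf (fun n =>
          ENNReal.ofReal ((1 - Real.exp (-((X t ω : ℝ) * a n))) / a n)) atTop ∂P :=
        lintegral_congr fun ω => (hlim ω).liminf_eq.symm
    _ ≤ liminf (fun n =>
          ∫⁻ ω, ENNReal.ofReal ((1 - Real.exp (-((X t ω : ℝ) * a n))) / a n) ∂P) atTop :=
        lintegral_liminf_le fun n => by fun_prop
    _ ≤ ENNReal.ofReal x :=
        (liminf_le_liminf (Eventually.of_forall hbound)).trans (by simp)
    _ < ∞ := ENNReal.ofReal_lt_top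

theorem measure_survival_pos [IsProbabilityMeasure P] [∀ t, IsMarkovKernel (Q t)]
    (hb : 0 ≤ ψ.b) (hv : ψ.IsCumulantSemigroup v)
    (hL : HasLaplaceExponent Q v)
    (hX : IsCadlagMarkov Q ℱ X P x) (hx : 0 < x) (s : ℝ≥0) : 0 < P (survival X s) := by
  rw [measure_congr (survival_ae_eq hb hv hL hX s)]
  refine pos_iff_ne_zero.2 fun h0 => ?_
  have hae : ∀ᵐ ω ∂P, X s ω = 0 := by
    rw [ae_iff]
    exact h0
  have h := integral_exp_neg hL hX s zero_le_one
  have h2 : ∫ ω, Real.exp (-((X s ω : ℝ) * 1)) ∂P = ∫ _, 1 ∂P := by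
    refine integral_congr_ae ?_
    filter_upwards [hae] with ω hω
    simp [hω]
  rw [h2, integral_const, probReal_univ, one_smul, eq_comm, Real.exp_eq_one_iff,
    neg_eq_zero] at h
  have hx' : (0 : ℝ) < x := by exact_mod_cast hx
  exact (mul_pos hx' (hv.pos hb s.coe_nonneg one_pos)).ne' h

theorem integral_cond_survival [IsProbabilityMeasure P] [∀ t, IsMarkovKernel (Q t)]
    (hb : 0 ≤ ψ.b) (hv : ψ.IsCumulantSemigroup v)
    (hL : HasLaplaceExponent Q v)
    (hX : IsCadlagMarkov Q ℱ X P x) (s : ℝ≥0) (F : Ω → ℝ) :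
    ∫ ω, F ω ∂(P[|survival X s]) =
      (∫ ω, F ω * Set.indicator {0}ᶜ 1 (X s ω) ∂P) /
        ∫ ω, Set.indicator {0}ᶜ (1 : ℝ≥0 → ℝ) (X s ω) ∂P := by
  have hae := survival_ae_eq hb hv hL hX s
  have hm : MeasurableSet {ω | X s ω ≠ 0} :=
    hX.measurable s (measurableSet_singleton 0).compl
  have h1 : ∀ G : Ω → ℝ, ∫ ω, G ω * Set.indicator {0}ᶜ 1 (X s ω) ∂P =
      ∫ ω in {ω | X s ω ≠ 0}, G ω ∂P := by
    intro G
    rw [← integral_indicator hm]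
    congr 1 with ω
    by_cases h : X s ω = 0 <;> simp [h]
  have h2 := h1 fun _ => 1
  simp only [one_mul, setIntegral_const, smul_eq_mul, mul_one] at h2
  rw [h1, h2, ProbabilityTheory.cond, Measure.restrict_congr_set hae, measure_congr hae,
    integral_smul_measure, ENNReal.toReal_inv, smul_eq_mul, div_eq_inv_mul]
  rfl

/-- The Markov property at time `t` gives `P(X_{t+r} ≠ 0 | ℱ_t) = 1 - e^{-X_t v̄_r}`. -/
theorem integral_mul_indicator [IsProbabilityMeasure P] [∀ t, IsMarkovKernel (Q t)]
    (hG : ψ.Grey) (hb : 0 ≤ ψ.b) (hv : ψ.IsCumulantSemigroup v)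
    (hL : HasLaplaceExponent Q v)
    (hX : IsCadlagMarkov Q ℱ X P x) (t : ℝ≥0) {r : ℝ≥0} (hr : 0 < r)
    {F : Ω → ℝ} (hF : Measurable[ℱ t] F) (hFb : ∃ C, ∀ ω, |F ω| ≤ C) :
    ∫ ω, F ω * Set.indicator {0}ᶜ 1 (X (t + r) ω) ∂P =
      ∫ ω, F ω * (1 - Real.exp (-((X t ω : ℝ) * extinctionExponent Q r))) ∂P := by
  have hm : MeasurableSet ({0}ᶜ : Set ℝ≥0) := (measurableSet_singleton 0).compl
  rw [hX.integral_mul_comp t r hF hFb (f := Set.indicator {0}ᶜ 1) (measurable_one.indicator hm)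
    ⟨1, fun y => by by_cases h : y = 0 <;> simp [h]⟩]
  congr 1 with ω
  rw [integral_indicator_one hm, probReal_compl_eq_one_sub (measurableSet_singleton 0),
    hv.real_singleton_zero hG hb hL hr]

theorem integral_indicator_ne_zero [IsProbabilityMeasure P] [∀ t, IsMarkovKernel (Q t)]
    (hG : ψ.Grey) (hb : 0 ≤ ψ.b) (hv : ψ.IsCumulantSemigroup v)
    (hL : HasLaplaceExponent Q v)
    (hX : IsCadlagMarkov Q ℱ X P x) (t : ℝ≥0) {r : ℝ≥0} (hr : 0 < r) :
    ∫ ω, Set.indicator {0}ᶜ (1 : ℝ≥0 → ℝ) (X (t + r) ω) ∂P =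
      1 - Real.exp (-((x : ℝ) * v t (extinctionExponent Q r))) := by
  have ha := (hv.extinctionExponent_pos hG hb hL hr).le
  have h := integral_mul_indicator hG hb hv hL hX t hr (F := fun _ => 1) measurable_const
    ⟨1, by simp⟩
  simp only [one_mul] at h
  rw [h, integral_sub (integrable_const _) (integrable_exp_neg (hX.measurable t) ha),
    integral_exp_neg hL hX t ha]
  simp

/-- `v̄_{t+r} = v_t(v̄_r)`. -/
theorem extinctionExponent_add [IsProbabilityMeasure P] [∀ t, IsMarkovKernel (Q t)]
    (hG : ψ.Grey) (hb : 0 ≤ ψ.b) (hv : ψ.IsCumulantSemigroup v)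
    (hL : HasLaplaceExponent Q v)
    (hX : IsCadlagMarkov Q ℱ X P x) (hx : 0 < x) (t : ℝ≥0) {r : ℝ≥0} (hr : 0 < r) :
    extinctionExponent Q (t + r) = v t (extinctionExponent Q r) := by
  have hm : MeasurableSet ({0}ᶜ : Set ℝ≥0) := (measurableSet_singleton 0).compl
  have h := integral_indicator_ne_zero hG hb hv hL hX t hr
  rw [hX.integral_comp (t + r) (f := Set.indicator {0}ᶜ 1) (measurable_one.indicator hm),
    integral_indicator_one hm, probReal_compl_eq_one_sub (measurableSet_singleton 0),
    hv.real_singleton_zero hG hb hL (add_pos_of_nonneg_of_pos zero_le hr)] at h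
  have h2 := Real.exp_injective (sub_right_injective h)
  have hx' : (x : ℝ) ≠ 0 := by exact_mod_cast hx.ne'
  exact mul_left_cancel₀ hx' (neg_injective h2)

theorem tendsto_extinctionExponent_atTop [IsProbabilityMeasure P] [∀ t, IsMarkovKernel (Q t)]
    (hG : ψ.Grey) (hb : 0 ≤ ψ.b) (hv : ψ.IsCumulantSemigroup v)
    (hL : HasLaplaceExponent Q v)
    (hX : IsCadlagMarkov Q ℱ X P x) (hx : 0 < x) :
    Tendsto (extinctionExponent Q) atTop (𝓝[>] 0) := by
  refine tendsto_nhdsWithin_iff.2 ⟨?_, ?_⟩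
  · have hshift : Tendsto (fun r : ℝ≥0 => ((r - 1 : ℝ≥0) : ℝ)) atTop atTop := by
      refine tendsto_atTop_mono (fun r => ?_)
        (tendsto_atTop_add_const_right _ (-1) (NNReal.tendsto_coe_atTop.2 tendsto_id))
      have h : (r : ℝ) ≤ (r - 1 : ℝ≥0) + 1 := by exact_mod_cast le_tsub_add (a := 1) (b := r)
      simp only [id]
      linarith
    have h1 := (hv.tendsto_atTop hG hb (hv.extinctionExponent_pos hG hb hL one_pos).le).comp hshift
    refine h1.congr' ?_
    filter_upwards [eventually_ge_atTop 1] with r hr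
    have h2 := extinctionExponent_add hG hb hv hL hX hx (r - 1) one_pos
    rw [tsub_add_cancel_of_le hr] at h2
    exact h2.symm
  · filter_upwards [eventually_gt_atTop 0] with r hr
    exact hv.extinctionExponent_pos hG hb hL hr

theorem tendsto_integral_mul_div [IsProbabilityMeasure P] (hX : IsCadlagMarkov Q ℱ X P x)
    (t : ℝ≥0) (hint : Integrable (fun ω => (X t ω : ℝ)) P)
    {F : Ω → ℝ} (hF : Measurable F) (hFb : ∃ C, ∀ ω, |F ω| ≤ C) :
    Tendsto (fun a => (∫ ω, F ω * (1 - Real.exp (-((X t ω : ℝ) * a))) ∂P) / a) (𝓝[>] 0)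
      (𝓝 (∫ ω, F ω * X t ω ∂P)) := by
  obtain ⟨C, hC⟩ := hFb
  have hXm := hX.measurable t
  simp_rw [← integral_div]
  refine tendsto_integral_filter_of_dominated_convergence (fun ω => C * X t ω) ?_ ?_
    (hint.const_mul C) ?_
  · exact Eventually.of_forall fun a => by fun_prop
  · filter_upwards [self_mem_nhdsWithin] with a ha
    have ha : 0 < a := ha
    refine Eventually.of_forall fun ω => ?_
    have h0 := one_sub_exp_neg_nonneg (mul_nonneg (X t ω).coe_nonneg ha.le)
    rw [mul_div_assoc, norm_mul, Real.norm_eq_abs, Real.norm_of_nonneg (div_nonneg h0 ha.le)]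
    refine mul_le_mul (hC ω) ?_ (div_nonneg h0 ha.le) ((abs_nonneg _).trans (hC ω))
    rw [div_le_iff₀ ha]
    exact one_sub_exp_neg_le _
  · refine Eventually.of_forall fun ω => ?_
    simp_rw [mul_div_assoc]
    exact (tendsto_one_sub_exp_neg_mul_div _).const_mul _

/-- The survival probability `1 - e^{-x v_t(a)}` is of order `x e^{-bt} a` as `a → 0`. -/
theorem tendsto_one_sub_exp_div (hb : 0 ≤ ψ.b) (hv : ψ.IsCumulantSemigroup v) (t x : ℝ≥0) :
    Tendsto (fun a => (1 - Real.exp (-((x : ℝ) * v t a))) / a) (𝓝[>] 0)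
      (𝓝 (x * Real.exp (-(ψ.b * t)))) := by
  have hv0 : Tendsto (fun a => v t a) (𝓝[>] 0) (𝓝[>] 0) := by
    refine tendsto_nhdsWithin_iff.2 ⟨?_, ?_⟩
    · refine tendsto_of_tendsto_of_tendsto_of_le_of_le' tendsto_const_nhds
        (tendsto_id.mono_left nhdsWithin_le_nhds) ?_ ?_
      · filter_upwards [self_mem_nhdsWithin] with a ha
        exact hv.nonneg t a t.coe_nonneg (le_of_lt ha)
      · filter_upwards [self_mem_nhdsWithin] with a ha
        exact hv.le_self hb t.coe_nonneg (le_of_lt ha)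
    · filter_upwards [self_mem_nhdsWithin] with a ha
      exact hv.pos hb t.coe_nonneg ha
  refine (((tendsto_one_sub_exp_neg_mul_div x).comp hv0).mul
    (hv.tendsto_div hb t.coe_nonneg)).congr' ?_
  filter_upwards [self_mem_nhdsWithin] with a ha
  have h1 : v t a ≠ 0 := (hv.pos hb t.coe_nonneg ha).ne'
  simp only [Function.comp_apply]
  field_simp

theorem tendsto_integral_cond_survival [IsProbabilityMeasure P] [∀ t, IsMarkovKernel (Q t)]
    (hG : ψ.Grey) (hb : 0 ≤ ψ.b) (hv : ψ.IsCumulantSemigroup v)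
    (hL : HasLaplaceExponent Q v)
    (hX : IsCadlagMarkov Q ℱ X P x) (hx : 0 < x) (t : ℝ≥0)
    {F : Ω → ℝ} (hF : Measurable[ℱ t] F) (hFb : ∃ C, ∀ ω, |F ω| ≤ C) :
    Tendsto (fun r : ℝ≥0 => ∫ ω, F ω ∂(P[|survival X (r + t)])) atTop
      (𝓝 (∫ ω, Real.exp (ψ.b * (t : ℝ)) * (X t ω : ℝ) * F ω / (x : ℝ) ∂P)) := by
  have hx' : (x : ℝ) ≠ 0 := by exact_mod_cast hx.ne'
  have hnum := tendsto_integral_mul_div hX t (integrable_process hb hv hL hX t)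
    (hF.mono (ℱ.le t) le_rfl) hFb
  have hden := tendsto_one_sub_exp_div hb hv t x
  have hlim := ((hnum.div hden (mul_ne_zero hx' (Real.exp_ne_zero _))).comp
    (tendsto_extinctionExponent_atTop hG hb hv hL hX hx))
  have hval : (∫ ω, F ω * X t ω ∂P) / (x * Real.exp (-(ψ.b * t))) =
      ∫ ω, Real.exp (ψ.b * (t : ℝ)) * (X t ω : ℝ) * F ω / (x : ℝ) ∂P := by
    rw [div_eq_mul_inv, ← integral_mul_const]
    congr 1 with ω
    rw [Real.exp_neg]
    have := Real.exp_ne_zero (ψ.b * (t : ℝ))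
    field_simp
  rw [hval] at hlim
  refine hlim.congr' ?_
  filter_upwards [eventually_gt_atTop 0] with r hr
  have ha := (hv.extinctionExponent_pos hG hb hL hr).ne'
  rw [integral_cond_survival hb hv hL hX, add_comm r t,
    integral_mul_indicator hG hb hv hL hX t hr hF hFb,
    integral_indicator_ne_zero hG hb hv hL hX t hr]
  simp only [Function.comp_apply, Pi.div_apply]
  exact div_div_div_cancel_right₀ ha _ _

/-- The size-biased law has total mass one: the limit theorem for `F = 1` identifies
`E[e^{bt} X_t / x]` as the limit of the constant `1`. -/
theorem isProbabilityMeasure_sizeBiased [IsProbabilityMeasure P] [∀ t, IsMarkovKernel (Q t)]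
    (hG : ψ.Grey) (hb : 0 ≤ ψ.b) (hv : ψ.IsCumulantSemigroup v)
    (hL : HasLaplaceExponent Q v)
    (hX : IsCadlagMarkov Q ℱ X P x) (hx : 0 < x) (t : ℝ≥0) :
    IsProbabilityMeasure (sizeBiased ψ.b Q t x) := by
  have h1 := tendsto_integral_cond_survival hG hb hv hL hX hx t (F := fun _ => 1)
    measurable_const ⟨1, by simp⟩
  have h2 : ∀ r : ℝ≥0, ∫ _, (1 : ℝ) ∂(P[|survival X (r + t)]) = 1 := by
    intro r
    have := cond_isProbabilityMeasure (measure_survival_pos hb hv hL hX hx (r + t)).ne'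
    simp
  simp only [h2, mul_one] at h1
  have h3 := tendsto_nhds_unique h1 tendsto_const_nhds
  constructor
  rw [sizeBiased, withDensity_apply _ MeasurableSet.univ, Measure.restrict_univ, ← hX.map_eq t,
    lintegral_map (by fun_prop) (hX.measurable t),
    ← ofReal_integral_eq_lintegral_ofReal ((integrable_process hb hv hL hX t).const_mul _)
      (Eventually.of_forall fun ω => by positivity), ← ENNReal.ofReal_one, ← h3]
  congr 2 with ω
  ring

end Limit

theorem theorem2p3p2 (ψ : BranchingMechanism) (hb : 0 ≤ ψ.b) (hGrey : ψ.Grey)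
    (Q : ℝ≥0 → Kernel ℝ≥0 ℝ≥0) (hQ : ψ.IsCBSemigroup Q)
    {Ω : Type*} {mΩ : MeasurableSpace Ω} (ℱ : Filtration ℝ≥0 mΩ)
    (X : ℝ≥0 → Ω → ℝ≥0) (P : Measure Ω) [IsProbabilityMeasure P]
    (x : ℝ≥0) (hx : 0 < x) (hX : IsCadlagMarkov Q ℱ X P x) (t : ℝ≥0) :
    (∀ r : ℝ≥0, 0 < P (survival X (r + t))) ∧
    (∃ (hr : ∀ r : ℝ≥0, IsProbabilityMeasure ((P[|survival X (r + t)]).map (X t)))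
       (hQb : IsProbabilityMeasure (sizeBiased ψ.b Q t x)),
      Tendsto (β := ProbabilityMeasure ℝ≥0)
        (fun r : ℝ≥0 => ⟨(P[|survival X (r + t)]).map (X t), hr r⟩)
        atTop (𝓝 ⟨sizeBiased ψ.b Q t x, hQb⟩)) ∧
    (∀ F : Ω → ℝ, Measurable[ℱ t] F → (∃ C, ∀ ω, |F ω| ≤ C) →
      Integrable (fun ω => Real.exp (ψ.b * (t : ℝ)) * (X t ω : ℝ) * F ω / (x : ℝ)) P ∧
      Tendsto (fun r : ℝ≥0 => ∫ ω, F ω ∂(P[|survival X (r + t)])) atTop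
        (𝓝 (∫ ω, Real.exp (ψ.b * (t : ℝ)) * (X t ω : ℝ) * F ω / (x : ℝ) ∂P))) := by
  have := hQ.isMarkovKernel
  obtain ⟨v, hv, hL⟩ := hQ.laplace
  have hpos := fun r : ℝ≥0 => measure_survival_pos hb hv hL hX hx (r + t)
  have hXm := hX.measurable t
  refine ⟨hpos, ⟨fun r => ?_, isProbabilityMeasure_sizeBiased hGrey hb hv hL hX hx t, ?_⟩,
    fun F hF hFb => ⟨?_, tendsto_integral_cond_survival hGrey hb hv hL hX hx t hF hFb⟩⟩
  · have := cond_isProbabilityMeasure (hpos r).ne'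
    exact Measure.isProbabilityMeasure_map hXm.aemeasurable
  · refine ProbabilityMeasure.tendsto_iff_forall_integral_tendsto.2 fun g => ?_
    have h := tendsto_integral_cond_survival hGrey hb hv hL hX hx t
      (F := fun ω => g (X t ω)) (g.continuous.measurable.comp (hX.adapted t))
      ⟨‖g‖, fun ω => g.norm_coe_le_norm _⟩
    have hval : ∫ ω, Real.exp (ψ.b * (t : ℝ)) * (X t ω : ℝ) * g (X t ω) / (x : ℝ) ∂P =
        ∫ y, g y ∂(sizeBiased ψ.b Q t x) := by
      have hdm : Measurable fun y : ℝ≥0 =>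
          ENNReal.ofReal (Real.exp (ψ.b * (t : ℝ)) * (x : ℝ)⁻¹ * (y : ℝ)) := by fun_prop
      rw [sizeBiased, integral_withDensity_eq_integral_toReal_smul hdm
        (Eventually.of_forall fun _ => ENNReal.ofReal_lt_top),
        ← hX.integral_comp t (f := fun y : ℝ≥0 =>
          (ENNReal.ofReal (Real.exp (ψ.b * (t : ℝ)) * (x : ℝ)⁻¹ * (y : ℝ))).toReal • g y)]
      · congr 1 with ω
        rw [ENNReal.toReal_ofReal (by positivity), smul_eq_mul]
        ring
      · exact hdm.ennreal_toReal.smul g.continuous.measurable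
    rw [hval] at h
    refine h.congr fun r => ?_
    exact (integral_map hXm.aemeasurable g.continuous.measurable.aestronglyMeasurable).symm
  · obtain ⟨C, hC⟩ := hFb
    have h := (((integrable_process hb hv hL hX t).bdd_mul
      (hF.mono (ℱ.le t) le_rfl).aestronglyMeasurable (Eventually.of_forall fun ω => hC ω)).const_mul
        (Real.exp (ψ.b * (t : ℝ)))).div_const (x : ℝ)
    refine h.congr (Eventually.of_forall fun ω => ?_)
    ring
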